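/- Let $n\ge 5$ be odd and let $\mathcal H_n=(\mathbb C^2)^{\otimes n}\cong\mathbb C^{2^n}$, with coordinates $\Phi_{\mathbf v}$, $\mathbf v\in\{0,1\}^n$, in the standard product basis. For $\Phi\in\mathcal H_n$ and $1\le i\le n$ let $\Phi_{(i)}$ be the mode-$i$ flattening, i.e. the $2\times 2^{n-1}$ matrix whose rows are indexed by the $i$-th index $v_i$ and whose columns are indexed by the remaining indices $(v_j)_{j\ne i}$, with entries $\Phi_{\mathbf v}$. Let $J=\begin{pmatrix}0&1\\-1&0\end{pmatrix}$, let $^\top$ denote the transpose (without complex conjugation), and order $\mathbb C$ lexicographically: $w<z$ if and only if $\operatorname{Re} w<\operatorname{Re} z$, or $\operatorname{Re} w=\operatorname{Re} z$ and $\operatorname{Im} w<\operatorname{Im} z$. Call $\Omega\in\mathcal H_n$ a core tensor for $\Phi\in\mathcal H_n$ if 1. $\Phi=(A_1\otimes\dots\otimes A_n)\Omega$ for some $A_1,\dots,A_n\in\operatorname{SL}_2(\mathbb C)$, and 2. for every $1\le i\le n$ we have $\Omega_{(i)}J^{\otimes(n-1)}\Omega_{(i)}^\top=z_iI_2$ for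 some $z_i\in\mathbb C$ with $z_i>-z_i$, and $\Omega_{(i)}\Omega_{(i)}^\top=\operatorname{diag}(\lambda_{i,1},\lambda_{i,2})$ for some $\lambda_{i,1},\lambda_{i,2}\in\mathbb C$ with $\lambda_{i,1}>\lambda_{i,2}$. Theorem. There is an open subset $U\subseteq\mathcal H_n$ (in the Euclidean topology) whose complement has Lebesgue measure zero such that every $\Phi\in U$ has a core tensor $\Omega$, and $\Omega$ is unique up to sign: the core tensors for $\Phi$ are exactly $\Omega$ and $-\Omega$. -/

import Mathlib

open scoped TensorProduct Matrix

namespace OddQubits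

/-- The space `(ℂ²)^{⊗n}` of unnormalized `n`-qubit state vectors. -/
abbrev QubitSpace (n : ℕ) : Type := ⨂[ℂ] _i : Fin n, (Fin 2 → ℂ)

/-- The computational basis `|v₁ … vₙ⟩ = |v₁⟩ ⊗ ⋯ ⊗ |vₙ⟩` of `(ℂ²)^{⊗n}`. -/
noncomputable def stdBasis (n : ℕ) : Module.Basis (Fin n → Fin 2) ℂ (QubitSpace n) :=
  Basis.piTensorProduct fun _ : Fin n => Pi.basisFun ℂ (Fin 2)

/-- The coordinates `Φ_v` of a tensor in the computational basis. -/
noncomputable def coords (n : ℕ) : QubitSpace n ≃ₗ[ℂ] ((Fin n → Fin 2) → ℂ) :=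
  (stdBasis n).equivFun

theorem coords_tprod {n : ℕ} (x : Fin n → Fin 2 → ℂ) (v : Fin n → Fin 2) :
    coords n (PiTensorProduct.tprod ℂ x) v = ∏ i, x i (v i) := by
  simp [coords, stdBasis]

/-- The operator `A₁ ⊗ ⋯ ⊗ Aₙ` on `(ℂ²)^{⊗n}` for `A₁, …, Aₙ ∈ SL₂(ℂ)`. -/
noncomputable def sloccAct {n : ℕ} (A : Fin n → Matrix.SpecialLinearGroup (Fin 2) ℂ) :
    QubitSpace n →ₗ[ℂ] QubitSpace n :=
  PiTensorProduct.map fun i => Matrix.toLin' (A i : Matrix (Fin 2) (Fin 2) ℂ)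

/-- The multi-index in `{0,1}ⁿ` whose `i`-th entry is `a` and whose other entries are given
by `w`. -/
def insertAt {n : ℕ} (i : Fin n) (a : Fin 2) (w : {j : Fin n // j ≠ i} → Fin 2) :
    Fin n → Fin 2 :=
  fun j => if h : j = i then a else w ⟨j, h⟩

/-- The mode-`i` flattening `Φ_(i)`, a `2 × 2^{n-1}` matrix; its columns are indexed by
`{0,1}^{n-1}`, the multi-indices on the tensor factors other than the `i`-th. -/
noncomputable def flattening {n : ℕ} (Φ : QubitSpace n) (i : Fin n) :
    Matrix (Fin 2) ({j : Fin n // j ≠ i} → Fin 2) ℂ :=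
  Matrix.of fun a w => coords n Φ (insertAt i a w)

/-- `J = [[0, 1], [-1, 0]]`. -/
def J : Matrix (Fin 2) (Fin 2) ℂ := !![0, 1; -1, 0]

/-- The Kronecker power `J^{⊗κ}`, one factor for each element of `κ`. -/
noncomputable def Jpow (κ : Type) [Fintype κ] : Matrix (κ → Fin 2) (κ → Fin 2) ℂ :=
  Matrix.of fun v w => ∏ j, J (v j) (w j)

/-- `Φ_(i) J^{⊗(n-1)} Φ_(i)ᵀ`. -/
noncomputable def symplecticReduction {n : ℕ} (Φ : QubitSpace n) (i : Fin n) :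
    Matrix (Fin 2) (Fin 2) ℂ :=
  flattening Φ i * Jpow {j : Fin n // j ≠ i} * (flattening Φ i)ᵀ

/-- `Φ_(i) Φ_(i)ᵀ` (transpose, without complex conjugation). -/
noncomputable def orthogonalReduction {n : ℕ} (Φ : QubitSpace n) (i : Fin n) :
    Matrix (Fin 2) (Fin 2) ℂ :=
  flattening Φ i * (flattening Φ i)ᵀ

/-- `lexLT w z` says that `w < z` in the lexicographic order on `ℂ`: real parts are compared
first, then imaginary parts. -/
def lexLT (w z : ℂ) : Prop := toLex (w.re, w.im) < toLex (z.re, z.im)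

theorem lexLT_iff (w z : ℂ) : lexLT w z ↔ w.re < z.re ∨ (w.re = z.re ∧ w.im < z.im) := by
  simp [lexLT, Prod.Lex.toLex_lt_toLex]

/-- `Ω` is a core tensor for `Φ`. -/
structure IsCoreTensor {n : ℕ} (Φ Ω : QubitSpace n) : Prop where
  sameOrbit : ∃ A : Fin n → Matrix.SpecialLinearGroup (Fin 2) ℂ, Φ = sloccAct A Ω
  symplectic : ∀ i : Fin n, ∃ z : ℂ, lexLT (-z) z ∧
    symplecticReduction Ω i = z • (1 : Matrix (Fin 2) (Fin 2) ℂ)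
  orthogonal : ∀ i : Fin n, ∃ l₁ l₂ : ℂ, lexLT l₂ l₁ ∧
    orthogonalReduction Ω i = Matrix.diagonal ![l₁, l₂]

/-- `P` holds for general `Φ`: it holds on an open subset of `(ℂ²)^{⊗n} ≅ ℂ^(2ⁿ)` whose
complement has Lebesgue measure zero. -/
def HoldsGenerically {n : ℕ} (P : QubitSpace n → Prop) : Prop :=
  ∃ U : Set ((Fin n → Fin 2) → ℂ), IsOpen U ∧ MeasureTheory.volume Uᶜ = 0 ∧
    ∀ Φ : QubitSpace n, coords n Φ ∈ U → P Φ

end OddQubits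

namespace OddQubits

/-! Since `Aᵀ J A = J` on `SL₂`, the matrix `S_i = Φ_(i) J^{⊗(n-1)} Φ_(i)ᵀ` transforms as `A_i S_i
A_iᵀ`, and it is symmetric because `n - 1` is even. A Cholesky factorization
(`exists_eq_smul_mul_transpose`) moves every `S_i` to a scalar. What remains is complex `SO₂` in
each mode, under which `Φ_(i) Φ_(i)ᵀ` is conjugated, so a rotation diagonalizes it when its
eigenvalues differ (`exists_rotation_diagonal`). The order conditions leave only `±1` in each mode
(`eq_sign_of_conj_diagonal`), hence one global sign.

Genericity must be a condition on `Φ` itself, while the eigenvalues are those of the normalized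
tensor. The invariant polynomial `modeDisc` solves this: on normalized tensors it is a nonzero
multiple of the eigenvalue discriminant. It remains to find one tensor, `ghzWitness`, where no
required polynomial vanishes. -/

/-! ### Zero loci of holomorphic functions are null sets. -/

open MeasureTheory Filter in
theorem measure_zero_locus_of_differentiable {E : Type*} [NormedAddCommGroup E] [NormedSpace ℂ E]
    [NormedSpace ℝ E] [IsScalarTower ℝ ℂ E] [FiniteDimensional ℝ E] [MeasurableSpace E]
    [BorelSpace E] (μ : Measure E) [μ.IsAddHaarMeasure] {f : E → ℂ} (hf : Differentiable ℂ f)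
    {w : E} (hw : f w ≠ 0) : μ {x | f x = 0} = 0 := by
  have hcont : Continuous f := hf.continuous
  -- On each real line through `w`, `f` is real analytic and nonzero at `t = 0`, so almost every `t`
  -- avoids its zeros; Fubini swaps `t` and `y`. One good `t ≠ 0` suffices, as `y ↦ w + t • y`
  -- preserves null sets.
  have key : ∀ᵐ t : ℝ, ∀ᵐ y ∂μ, f (w + t • y) ≠ 0 := by
    rw [Measure.ae_ae_comm]
    · refine Eventually.of_forall fun y => ?_
      have hg : AnalyticOnNhd ℝ (fun t : ℝ => f (w + t • y)) Set.univ := by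
        intro t _
        have hF : Differentiable ℂ fun z : ℂ => f (w + z • y) := by fun_prop
        have := ((hF.analyticAt (t : ℂ)).restrictScalars (𝕜 := ℝ)).comp_of_eq
          (Complex.ofRealCLM.analyticAt t) rfl
        have e : ∀ t : ℝ, t • y = (t : ℂ) • y := fun t => (algebraMap_smul ℂ t y).symm
        simp only [e]
        exact this
      rcases hg.eqOn_zero_or_eventually_ne_zero_of_preconnected isPreconnected_univ with h | h
      · exact absurd (by simpa using h (Set.mem_univ (0 : ℝ))) hw
      · have := ae_restrict_le_codiscreteWithin (μ := volume) (MeasurableSet.univ (α := ℝ)) h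
        rwa [Measure.restrict_univ] at this
    · have : Continuous fun p : ℝ × E => f (w + p.1 • p.2) := by fun_prop
      exact (isOpen_ne_fun this continuous_const).measurableSet
  obtain ⟨t, ht, ht0⟩ := (key.and (Measure.ae_ne volume (0 : ℝ))).exists
  have h1 : μ ((fun y => t • y) ⁻¹' ((fun y => w + y) ⁻¹' {x | f x = 0})) = 0 := by
    have := ae_iff.1 ht
    simpa using this
  rw [Measure.addHaar_preimage_smul μ ht0, measure_preimage_add] at h1
  refine (mul_eq_zero.1 h1).resolve_left ?_
  simp [ht0]

theorem holdsGenerically_of_differentiable {n : ℕ} {f : ((Fin n → Fin 2) → ℂ) → ℂ}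
    (hf : Differentiable ℂ f) {w : (Fin n → Fin 2) → ℂ} (hw : f w ≠ 0)
    {P : QubitSpace n → Prop} (hP : ∀ Φ, f (coords n Φ) ≠ 0 → P Φ) : HoldsGenerically P := by
  refine ⟨{x | f x ≠ 0}, isOpen_ne_fun hf.continuous continuous_const, ?_, fun Φ h => hP Φ h⟩
  have h : {x | f x ≠ 0}ᶜ = {x | f x = 0} := by ext x; simp
  rw [h]
  exact measure_zero_locus_of_differentiable _ hf hw

/-! ### Kronecker products and the local action in coordinates. -/

/-- The Kronecker product of a family of `2 × 2` matrices. -/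
def kron {κ : Type*} [Fintype κ] (B : κ → Matrix (Fin 2) (Fin 2) ℂ) :
    Matrix (κ → Fin 2) (κ → Fin 2) ℂ :=
  Matrix.of fun v w => ∏ j, B j (v j) (w j)

section kron
variable {κ : Type*} [Fintype κ]

theorem kron_apply (B : κ → Matrix (Fin 2) (Fin 2) ℂ) (v w : κ → Fin 2) :
    kron B v w = ∏ j, B j (v j) (w j) := rfl

theorem kron_transpose (B : κ → Matrix (Fin 2) (Fin 2) ℂ) :
    (kron B)ᵀ = kron fun j => (B j)ᵀ := rfl

theorem kron_mul [DecidableEq κ] (B C : κ → Matrix (Fin 2) (Fin 2) ℂ) :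
    kron B * kron C = kron fun j => B j * C j := by
  ext v w
  simp only [Matrix.mul_apply, kron_apply, ← Finset.prod_mul_distrib]
  rw [Finset.prod_univ_sum]
  simp

theorem kron_smul (c : κ → ℂ) (B : κ → Matrix (Fin 2) (Fin 2) ℂ) :
    (kron fun j => c j • B j) = (∏ j, c j) • kron B := by
  ext v w
  simp [kron_apply, Finset.prod_mul_distrib]

theorem kron_one [DecidableEq κ] : kron (fun _ : κ => (1 : Matrix (Fin 2) (Fin 2) ℂ)) = 1 := by
  ext v w
  simp only [kron_apply, Matrix.one_apply, Finset.prod_ite_zero, funext_iff]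
  simp

end kron

variable {n : ℕ}

theorem coords_sloccAct (A : Fin n → Matrix.SpecialLinearGroup (Fin 2) ℂ) (Ω : QubitSpace n) :
    coords n (sloccAct A Ω) = kron (fun i => (A i : Matrix (Fin 2) (Fin 2) ℂ)) *ᵥ coords n Ω := by
  have h : (coords n).toLinearMap ∘ₗ sloccAct A =
      Matrix.toLin' (kron fun i => (A i : Matrix (Fin 2) (Fin 2) ℂ)) ∘ₗ
        (coords n).toLinearMap := by
    refine PiTensorProduct.ext (MultilinearMap.ext fun x => funext fun v => ?_)
    simp only [LinearMap.compMultilinearMap_apply, LinearMap.comp_apply, sloccAct,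
      PiTensorProduct.map_tprod, LinearEquiv.coe_coe, coords_tprod, Matrix.toLin'_apply,
      Matrix.mulVec, dotProduct, kron_apply, ← Finset.prod_mul_distrib]
    rw [Finset.prod_univ_sum]
    simp
  exact LinearMap.congr_fun h Ω

theorem sloccAct_mul (A B : Fin n → Matrix.SpecialLinearGroup (Fin 2) ℂ) (Ω : QubitSpace n) :
    sloccAct (A * B) Ω = sloccAct A (sloccAct B Ω) := by
  apply (coords n).injective
  simp [coords_sloccAct, kron_mul]

theorem sloccAct_of_forall_eq_smul (A : Fin n → Matrix.SpecialLinearGroup (Fin 2) ℂ)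
    (c : Fin n → ℂ) (h : ∀ i, (A i : Matrix (Fin 2) (Fin 2) ℂ) = c i • 1) (Ω : QubitSpace n) :
    sloccAct A Ω = (∏ i, c i) • Ω := by
  apply (coords n).injective
  simp [coords_sloccAct, h, kron_smul, kron_one, Matrix.smul_mulVec]

theorem sloccAct_one (Ω : QubitSpace n) : sloccAct 1 Ω = Ω := by
  simpa using sloccAct_of_forall_eq_smul 1 (fun _ => 1) (by simp) Ω

theorem insertAt_eq_funSplitAt_symm (i : Fin n) (a : Fin 2) (w : {j : Fin n // j ≠ i} → Fin 2) :
    insertAt i a w = (Equiv.funSplitAt i (Fin 2)).symm (a, w) := by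
  ext j
  by_cases h : j = i
  · subst h; simp [insertAt]
  · simp [insertAt, h]

theorem kron_insertAt (A : Fin n → Matrix (Fin 2) (Fin 2) ℂ) (i : Fin n) (a b : Fin 2)
    (v w : {j : Fin n // j ≠ i} → Fin 2) :
    kron A (insertAt i a v) (insertAt i b w) =
      A i a b * kron (fun j : {j : Fin n // j ≠ i} => A j) v w := by
  simp only [kron_apply]
  rw [Fintype.prod_eq_mul_prod_subtype_ne _ i]
  congr 1
  · simp [insertAt]
  · exact Finset.prod_congr rfl fun j _ => by simp [insertAt, j.2]

theorem flattening_sloccAct (A : Fin n → Matrix.SpecialLinearGroup (Fin 2) ℂ) (Ω : QubitSpace n)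
    (i : Fin n) :
    flattening (sloccAct A Ω) i = (A i : Matrix (Fin 2) (Fin 2) ℂ) * flattening Ω i *
      (kron fun j : {j : Fin n // j ≠ i} => (A j : Matrix (Fin 2) (Fin 2) ℂ))ᵀ := by
  ext a v
  simp only [flattening, Matrix.of_apply, coords_sloccAct, Matrix.mulVec, dotProduct,
    Matrix.mul_apply, Matrix.transpose_apply, Finset.sum_mul]
  rw [← (Equiv.funSplitAt i (Fin 2)).symm.sum_comp, Fintype.sum_prod_type, Finset.sum_comm]
  refine Finset.sum_congr rfl fun w _ => Finset.sum_congr rfl fun b _ => ?_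
  rw [← insertAt_eq_funSplitAt_symm, kron_insertAt]
  ring

/-! ### Covariance of the reductions. -/

/-- `Φ_(i) (⨂_{j ≠ i} B_j) Φ_(i)ᵀ`. -/
noncomputable def reduction (Φ : QubitSpace n) (i : Fin n)
    (B : Fin n → Matrix (Fin 2) (Fin 2) ℂ) : Matrix (Fin 2) (Fin 2) ℂ :=
  flattening Φ i * kron (fun j : {j : Fin n // j ≠ i} => B j) * (flattening Φ i)ᵀ

theorem symplecticReduction_eq (Φ : QubitSpace n) (i : Fin n) :
    symplecticReduction Φ i = reduction Φ i fun _ => J := rfl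

theorem orthogonalReduction_eq (Φ : QubitSpace n) (i : Fin n) :
    orthogonalReduction Φ i = reduction Φ i fun _ => 1 := by
  simp [orthogonalReduction, reduction, kron_one]

theorem reduction_sloccAct (A : Fin n → Matrix.SpecialLinearGroup (Fin 2) ℂ) (Ω : QubitSpace n)
    (i : Fin n) (B : Fin n → Matrix (Fin 2) (Fin 2) ℂ) :
    reduction (sloccAct A Ω) i B = (A i : Matrix (Fin 2) (Fin 2) ℂ) *
      reduction Ω i (fun j => (A j : Matrix (Fin 2) (Fin 2) ℂ)ᵀ * B j * A j) *
      (A i : Matrix (Fin 2) (Fin 2) ℂ)ᵀ := by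
  simp only [reduction, flattening_sloccAct, ← kron_mul, ← kron_transpose, Matrix.transpose_mul,
    Matrix.transpose_transpose, Matrix.mul_assoc]

theorem reduction_transpose (Φ : QubitSpace n) (i : Fin n)
    (B : Fin n → Matrix (Fin 2) (Fin 2) ℂ) :
    (reduction Φ i B)ᵀ = reduction Φ i fun j => (B j)ᵀ := by
  simp only [reduction, Matrix.transpose_mul, Matrix.transpose_transpose, kron_transpose,
    Matrix.mul_assoc]

theorem reduction_smul (Φ : QubitSpace n) (i : Fin n) (c : Fin n → ℂ)
    (B : Fin n → Matrix (Fin 2) (Fin 2) ℂ) :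
    reduction Φ i (fun j => c j • B j) =
      (∏ j : {j : Fin n // j ≠ i}, c j) • reduction Φ i B := by
  simp [reduction, kron_smul]

theorem transpose_mul_J_mul (A : Matrix.SpecialLinearGroup (Fin 2) ℂ) :
    (A : Matrix (Fin 2) (Fin 2) ℂ)ᵀ * J * A = J := by
  have h := A.2
  rw [Matrix.det_fin_two] at h
  ext i j
  fin_cases i <;> fin_cases j <;> simp [J, Matrix.mul_apply, Fin.sum_univ_two] <;>
    first | ring1 | linear_combination h | linear_combination -h

theorem symplecticReduction_sloccAct (A : Fin n → Matrix.SpecialLinearGroup (Fin 2) ℂ)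
    (Ω : QubitSpace n) (i : Fin n) :
    symplecticReduction (sloccAct A Ω) i = (A i : Matrix (Fin 2) (Fin 2) ℂ) *
      symplecticReduction Ω i * (A i : Matrix (Fin 2) (Fin 2) ℂ)ᵀ := by
  simp only [symplecticReduction_eq, reduction_sloccAct, transpose_mul_J_mul]

theorem J_transpose : Jᵀ = (-1 : ℂ) • J := by
  ext i j; fin_cases i <;> fin_cases j <;> simp [J]

/-- Transposing each `J` costs a sign, and there are `n - 1` of them, an even number. -/
theorem symplecticReduction_transpose (hn : Odd n) (Φ : QubitSpace n) (i : Fin n) :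
    (symplecticReduction Φ i)ᵀ = symplecticReduction Φ i := by
  obtain ⟨k, rfl⟩ := hn
  rw [symplecticReduction_eq, reduction_transpose]
  simp only [J_transpose]
  rw [reduction_smul]
  simp

theorem orthogonalReduction_transpose (Φ : QubitSpace n) (i : Fin n) :
    (orthogonalReduction Φ i)ᵀ = orthogonalReduction Φ i := by
  simp [orthogonalReduction]

/-- Orthogonal local operations conjugate the orthogonal reductions. -/
theorem orthogonalReduction_sloccAct (A : Fin n → Matrix.SpecialLinearGroup (Fin 2) ℂ)
    (hA : ∀ j, (A j : Matrix (Fin 2) (Fin 2) ℂ)ᵀ * A j = 1) (Ω : QubitSpace n) (i : Fin n) :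
    orthogonalReduction (sloccAct A Ω) i = (A i : Matrix (Fin 2) (Fin 2) ℂ) *
      orthogonalReduction Ω i * (A i : Matrix (Fin 2) (Fin 2) ℂ)ᵀ := by
  simp only [orthogonalReduction_eq, reduction_sloccAct, Matrix.mul_one, hA]

/-! ### Lexicographic order and the choice of square roots. -/

theorem lexLT_or_lexLT_of_ne {w z : ℂ} (h : w ≠ z) : lexLT w z ∨ lexLT z w := by
  simp only [lexLT]
  refine lt_or_gt_of_ne fun e => h ?_
  have := toLex.injective e
  simp only [Prod.mk.injEq] at this
  exact Complex.ext this.1 this.2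

theorem lexLT_asymm {w z : ℂ} (h : lexLT w z) : ¬ lexLT z w := by
  simp only [lexLT] at *
  exact lt_asymm h

theorem lexLT.ne {w z : ℂ} (h : lexLT w z) : w ≠ z := by
  rintro rfl
  exact lexLT_asymm h h

theorem ne_zero_of_lexLT_neg {z : ℂ} (h : lexLT (-z) z) : z ≠ 0 := by
  rintro rfl
  exact h.ne (by simp)

theorem eq_of_sq_eq_sq_of_lexLT {w z : ℂ} (hw : lexLT (-w) w) (hz : lexLT (-z) z)
    (h : w ^ 2 = z ^ 2) : w = z := by
  rcases sq_eq_sq_iff_eq_or_eq_neg.1 h with h | rfl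
  · exact h
  · rw [neg_neg] at hw
    exact absurd hz (lexLT_asymm hw)

theorem exists_sq_eq (a : ℂ) : ∃ r : ℂ, r ^ 2 = a := IsAlgClosed.exists_pow_nat_eq a two_pos

theorem exists_sq_eq_lexLT {a : ℂ} (ha : a ≠ 0) : ∃ z : ℂ, z ^ 2 = a ∧ lexLT (-z) z := by
  obtain ⟨r, hr⟩ := exists_sq_eq a
  have hr0 : r ≠ 0 := by rintro rfl; exact ha (by simpa using hr.symm)
  rcases lexLT_or_lexLT_of_ne (w := -r) (z := r)
      (fun h => hr0 (self_eq_neg.1 h.symm)) with h | h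
  · exact ⟨r, hr, h⟩
  · exact ⟨-r, by rw [neg_sq, hr], by rwa [neg_neg]⟩

/-! ### Normal forms of complex symmetric `2 × 2` matrices. -/

theorem isSymm_fin_two {S : Matrix (Fin 2) (Fin 2) ℂ} (h : Sᵀ = S) : S 1 0 = S 0 1 :=
  congrFun (congrFun h 0) 1

/-- Cholesky factorization of a complex symmetric `2 × 2` matrix, normalized to `SL₂(ℂ)`. -/
theorem exists_eq_smul_mul_transpose {S : Matrix (Fin 2) (Fin 2) ℂ} (hS : Sᵀ = S)
    (h0 : S 0 0 ≠ 0) (hdet : S.det ≠ 0) :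
    ∃ (z : ℂ) (A : Matrix.SpecialLinearGroup (Fin 2) ℂ), lexLT (-z) z ∧
      S = z • ((A : Matrix (Fin 2) (Fin 2) ℂ) * (A : Matrix (Fin 2) (Fin 2) ℂ)ᵀ) := by
  -- With `z² = det S`, the matrix `S / z` has determinant one, so its triangular factor can be
  -- taken in `SL₂`.
  obtain ⟨z, hz, hlt⟩ := exists_sq_eq_lexLT hdet
  have hz0 := ne_zero_of_lexLT_neg hlt
  obtain ⟨r, hr⟩ := exists_sq_eq (S 0 0 / z)
  have hr0 : r ≠ 0 := by
    rintro rfl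
    exact div_ne_zero h0 hz0 (by simpa using hr.symm)
  have h10 := isSymm_fin_two hS
  rw [Matrix.det_fin_two, h10] at hz
  have hr' : z * r ^ 2 = S 0 0 := by rw [hr]; field_simp
  refine ⟨z, ⟨!![r, 0; S 0 1 / (z * r), r⁻¹], by simp [hr0]⟩, hlt, ?_⟩
  ext i j
  fin_cases i <;> fin_cases j <;>
    simp [Matrix.vecMul, dotProduct, Fin.sum_univ_two, h10]
  · rw [← hr']; ring
  · field_simp
  · field_simp
  · field_simp
    rw [← hr'] at hz
    linear_combination -hz

/-- `tr(N adj S)² - 4 det N det S`; up to a unit, the discriminant of the pencil of `N`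
and `S`. -/
noncomputable def pencilDisc (N S : Matrix (Fin 2) (Fin 2) ℂ) : ℂ :=
  (N * S.adjugate).trace ^ 2 - 4 * N.det * S.det

/-- The congruence by `A` turns `N adj S` into its conjugate by `A`, so trace and determinants
persist. -/
theorem pencilDisc_conj (A : Matrix.SpecialLinearGroup (Fin 2) ℂ)
    (N S : Matrix (Fin 2) (Fin 2) ℂ) :
    pencilDisc ((A : Matrix (Fin 2) (Fin 2) ℂ) * N * (A : Matrix (Fin 2) (Fin 2) ℂ)ᵀ)
      ((A : Matrix (Fin 2) (Fin 2) ℂ) * S * (A : Matrix (Fin 2) (Fin 2) ℂ)ᵀ) =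
    pencilDisc N S := by
  have h1 : (A : Matrix (Fin 2) (Fin 2) ℂ).adjugate * A = 1 := by
    rw [Matrix.adjugate_mul, A.2, one_smul]
  have h2 : (A : Matrix (Fin 2) (Fin 2) ℂ)ᵀ * (A : Matrix (Fin 2) (Fin 2) ℂ)ᵀ.adjugate = 1 := by
    rw [Matrix.mul_adjugate, Matrix.det_transpose, A.2, one_smul]
  have h3 : (A : Matrix (Fin 2) (Fin 2) ℂ) * N * (A : Matrix (Fin 2) (Fin 2) ℂ)ᵀ *
      ((A : Matrix (Fin 2) (Fin 2) ℂ) * S * (A : Matrix (Fin 2) (Fin 2) ℂ)ᵀ).adjugate =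
      (A : Matrix (Fin 2) (Fin 2) ℂ) * (N * S.adjugate) *
        (A : Matrix (Fin 2) (Fin 2) ℂ).adjugate := by
    rw [Matrix.adjugate_mul_distrib, Matrix.adjugate_mul_distrib]
    simp only [Matrix.mul_assoc]
    rw [← Matrix.mul_assoc (A : Matrix (Fin 2) (Fin 2) ℂ)ᵀ, h2, Matrix.one_mul]
  rw [pencilDisc, pencilDisc, h3, Matrix.trace_mul_comm, ← Matrix.mul_assoc, h1, Matrix.one_mul]
  simp

theorem pencilDisc_smul_smul_one (c z : ℂ) (N : Matrix (Fin 2) (Fin 2) ℂ) :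
    pencilDisc (c • N) (z • 1) = c ^ 2 * z ^ 2 * (N.trace ^ 2 - 4 * N.det) := by
  simp [pencilDisc, Matrix.adjugate_fin_two, Matrix.det_fin_two, Matrix.trace_fin_two,
    Matrix.mul_apply, Fin.sum_univ_two]
  ring

/-- A complex symmetric `2 × 2` matrix with distinct eigenvalues is diagonalized by a complex
rotation, with the eigenvalues in any prescribed order. -/
theorem exists_rotation_diagonal {T : Matrix (Fin 2) (Fin 2) ℂ} (hT : Tᵀ = T)
    (hdisc : T.trace ^ 2 - 4 * T.det ≠ 0) :
    ∃ (O : Matrix.SpecialLinearGroup (Fin 2) ℂ) (l₁ l₂ : ℂ), lexLT l₂ l₁ ∧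
      (O : Matrix (Fin 2) (Fin 2) ℂ) * (O : Matrix (Fin 2) (Fin 2) ℂ)ᵀ = 1 ∧
      T = (O : Matrix (Fin 2) (Fin 2) ℂ) * Matrix.diagonal ![l₁, l₂] *
        (O : Matrix (Fin 2) (Fin 2) ℂ)ᵀ := by
  have h10 := isSymm_fin_two hT
  rw [Matrix.trace_fin_two, Matrix.det_fin_two, h10] at hdisc
  obtain ⟨l₁, l₂, hlt, htr, hd⟩ : ∃ l₁ l₂ : ℂ, lexLT l₂ l₁ ∧ l₁ + l₂ = T 0 0 + T 1 1 ∧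
      (l₁ - l₂) ^ 2 = (T 0 0 + T 1 1) ^ 2 - 4 * (T 0 0 * T 1 1 - T 0 1 * T 0 1) := by
    obtain ⟨r, hr⟩ := exists_sq_eq
      ((T 0 0 + T 1 1) ^ 2 - 4 * (T 0 0 * T 1 1 - T 0 1 * T 0 1))
    have hr0 : r ≠ 0 := by rintro rfl; exact hdisc (by simpa using hr.symm)
    have hne : (T 0 0 + T 1 1 - r) / 2 ≠ (T 0 0 + T 1 1 + r) / 2 := by
      intro h
      exact hr0 (by linear_combination -h)
    rcases lexLT_or_lexLT_of_ne hne with h | h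
    · exact ⟨_, _, h, by ring, by rw [← hr]; ring⟩
    · exact ⟨_, _, h, by ring, by rw [← hr]; ring⟩
  have hr0 : l₁ - l₂ ≠ 0 := sub_ne_zero.2 hlt.ne.symm
  have hprod : (l₁ - T 1 1) * (l₁ - T 0 0) = T 0 1 ^ 2 := by
    obtain rfl : l₂ = T 0 0 + T 1 1 - l₁ := by linear_combination htr
    linear_combination hd / 4
  -- `x` and `y` are the cosine and sine of the rotation: the diagonal of `T` forces their squares,
  -- and the off-diagonal entry `(l₁ - l₂) x y` fixes the sign of `y`.
  obtain ⟨x, hx⟩ := exists_sq_eq ((l₁ - T 1 1) / (l₁ - l₂))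
  obtain ⟨y, hy, hxy⟩ : ∃ y : ℂ, y ^ 2 = (l₁ - T 0 0) / (l₁ - l₂) ∧
      (l₁ - l₂) * (x * y) = T 0 1 := by
    obtain ⟨y, hy⟩ := exists_sq_eq ((l₁ - T 0 0) / (l₁ - l₂))
    have : ((l₁ - l₂) * (x * y)) ^ 2 = T 0 1 ^ 2 := by
      rw [mul_pow, mul_pow, hx, hy, ← hprod]
      field_simp
    rcases sq_eq_sq_iff_eq_or_eq_neg.1 this with h | h
    · exact ⟨y, hy, h⟩
    · exact ⟨-y, by rw [neg_sq, hy], by linear_combination -h⟩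
  have hx' : (l₁ - l₂) * x ^ 2 = l₁ - T 1 1 := by rw [hx]; field_simp
  have hy' : (l₁ - l₂) * y ^ 2 = l₁ - T 0 0 := by rw [hy]; field_simp
  have hone : x ^ 2 + y ^ 2 = 1 := by
    apply mul_left_cancel₀ hr0
    linear_combination hx' + hy' + htr
  refine ⟨⟨!![x, -y; y, x], by simp; linear_combination hone⟩, l₁, l₂, hlt, ?_, ?_⟩
  · ext i j
    fin_cases i <;> fin_cases j <;> simp [Matrix.mul_apply, Fin.sum_univ_two] <;>
      first | ring1 | linear_combination hone
  · ext i j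
    fin_cases i <;> fin_cases j <;>
      simp [Matrix.mul_apply, Matrix.vecMul, dotProduct, Fin.sum_univ_two, h10]
    · linear_combination hy' - l₁ * hone
    · linear_combination -hxy
    · linear_combination -hxy
    · linear_combination hx' - l₁ * hone

/-- An orthogonal matrix of determinant one that conjugates an ordered diagonal matrix with
distinct entries to another such matrix is a sign. -/
theorem eq_sign_of_conj_diagonal {O : Matrix.SpecialLinearGroup (Fin 2) ℂ} {l₁ l₂ m₁ m₂ : ℂ}
    (hl : lexLT l₂ l₁) (hm : lexLT m₂ m₁)
    (hO : (O : Matrix (Fin 2) (Fin 2) ℂ) * (O : Matrix (Fin 2) (Fin 2) ℂ)ᵀ = 1)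
    (h : (O : Matrix (Fin 2) (Fin 2) ℂ) * Matrix.diagonal ![l₁, l₂] *
      (O : Matrix (Fin 2) (Fin 2) ℂ)ᵀ = Matrix.diagonal ![m₁, m₂]) :
    ∃ c : ℂ, (c = 1 ∨ c = -1) ∧ (O : Matrix (Fin 2) (Fin 2) ℂ) = c • 1 := by
  have hT : (O : Matrix (Fin 2) (Fin 2) ℂ)ᵀ = (O : Matrix (Fin 2) (Fin 2) ℂ).adjugate := by
    calc _ = (O : Matrix (Fin 2) (Fin 2) ℂ).adjugate * O * (O : Matrix (Fin 2) (Fin 2) ℂ)ᵀ := by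
          rw [Matrix.adjugate_mul, O.2, one_smul, Matrix.one_mul]
      _ = _ := by rw [Matrix.mul_assoc, hO, Matrix.mul_one]
  rw [Matrix.adjugate_fin_two] at hT
  have e1 : O 1 1 = O 0 0 := by simpa using (congrFun (congrFun hT 0) 0).symm
  have e2 : O 1 0 = - O 0 1 := by simpa using congrFun (congrFun hT 0) 1
  have hdet := O.2
  rw [Matrix.det_fin_two, e1, e2] at hdet
  have h00 := congrFun (congrFun h 0) 0
  have h01 := congrFun (congrFun h 0) 1
  have h11 := congrFun (congrFun h 1) 1
  simp [Matrix.mul_apply, Fin.sum_univ_two, Matrix.diagonal_apply, e1, e2] at h00 h01 h11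
  have hxy : O 0 0 * O 0 1 = 0 := by
    refine (mul_eq_zero.1 (?_ : (l₁ - l₂) * (O 0 0 * O 0 1) = 0)).resolve_left
      (sub_ne_zero.2 hl.ne.symm)
    linear_combination -h01
  -- A vanishing cosine would swap the two eigenvalues, against their order.
  rcases mul_eq_zero.1 hxy with hx | hy
  · exfalso
    rw [hx] at h00 h11 hdet
    have a1 : m₁ = l₂ := by linear_combination -h00 + l₂ * hdet
    have a2 : m₂ = l₁ := by linear_combination -h11 + l₁ * hdet
    rw [a1, a2] at hm
    exact lexLT_asymm hl hm
  · refine ⟨O 0 0, ?_, ?_⟩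
    · rw [hy] at hdet
      exact sq_eq_sq_iff_eq_or_eq_neg.1 (by linear_combination hdet)
    · ext i j
      fin_cases i <;> fin_cases j <;> simp [e1, e2, hy]

/-! ### The invariant discriminant. -/

/-- The pencil discriminant of the covariants
`Φ_(i) (⨂_{j ≠ i} adj S_j) Φ_(i)ᵀ` and `S_i`, where `S_j = Φ_(j) J^{⊗(n-1)} Φ_(j)ᵀ`. -/
noncomputable def modeDisc (Φ : QubitSpace n) (i : Fin n) : ℂ :=
  pencilDisc (reduction Φ i fun j => (symplecticReduction Φ j).adjugate) (symplecticReduction Φ i)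

/-- `adj S_j` transforms contragrediently and so absorbs the action in the modes `j ≠ i`; mode `i`
acts by a simultaneous congruence, which `pencilDisc` does not see. -/
theorem modeDisc_sloccAct (A : Fin n → Matrix.SpecialLinearGroup (Fin 2) ℂ) (Φ : QubitSpace n)
    (i : Fin n) : modeDisc (sloccAct A Φ) i = modeDisc Φ i := by
  have h : ∀ (B : Matrix.SpecialLinearGroup (Fin 2) ℂ) (S : Matrix (Fin 2) (Fin 2) ℂ),
      (B : Matrix (Fin 2) (Fin 2) ℂ)ᵀ *
        ((B : Matrix (Fin 2) (Fin 2) ℂ) * S * (B : Matrix (Fin 2) (Fin 2) ℂ)ᵀ).adjugate *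
        (B : Matrix (Fin 2) (Fin 2) ℂ) = S.adjugate := by
    intro B S
    have h1 : (B : Matrix (Fin 2) (Fin 2) ℂ).adjugate * B = 1 := by
      rw [Matrix.adjugate_mul, B.2, one_smul]
    have h2 : (B : Matrix (Fin 2) (Fin 2) ℂ)ᵀ * (B : Matrix (Fin 2) (Fin 2) ℂ)ᵀ.adjugate = 1 := by
      rw [Matrix.mul_adjugate, Matrix.det_transpose, B.2, one_smul]
    simp only [Matrix.adjugate_mul_distrib, Matrix.mul_assoc, h1, Matrix.mul_one]
    rw [← Matrix.mul_assoc, h2, Matrix.one_mul]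
  simp only [modeDisc, reduction_sloccAct, symplecticReduction_sloccAct, h, pencilDisc_conj]

theorem modeDisc_of_symplecticReduction_eq_smul_one {Φ : QubitSpace n} {z : Fin n → ℂ}
    (h : ∀ j, symplecticReduction Φ j = z j • 1) (i : Fin n) :
    modeDisc Φ i = (∏ j : {j : Fin n // j ≠ i}, z j) ^ 2 * z i ^ 2 *
      ((orthogonalReduction Φ i).trace ^ 2 - 4 * (orthogonalReduction Φ i).det) := by
  have hadj : ∀ c : ℂ, (c • (1 : Matrix (Fin 2) (Fin 2) ℂ)).adjugate = c • 1 := by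
    intro c
    simp [Matrix.adjugate_smul]
  simp only [modeDisc, h, hadj]
  rw [reduction_smul, pencilDisc_smul_smul_one, orthogonalReduction_eq]

/-! ### Existence and uniqueness of core tensors. -/

theorem exists_isCoreTensor (hn : Odd n) {Φ : QubitSpace n}
    (h0 : ∀ i, symplecticReduction Φ i 0 0 ≠ 0) (hdet : ∀ i, (symplecticReduction Φ i).det ≠ 0)
    (hdisc : ∀ i, modeDisc Φ i ≠ 0) : ∃ Ω, IsCoreTensor Φ Ω := by
  choose z A hz hA using fun i =>
    exists_eq_smul_mul_transpose (symplecticReduction_transpose hn Φ i) (h0 i) (hdet i)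
  have hinv : ∀ B : Matrix.SpecialLinearGroup (Fin 2) ℂ,
      ((B⁻¹ : Matrix.SpecialLinearGroup (Fin 2) ℂ) : Matrix (Fin 2) (Fin 2) ℂ) * B = 1 := by
    intro B
    rw [← Matrix.SpecialLinearGroup.coe_mul, inv_mul_cancel, Matrix.SpecialLinearGroup.coe_one]
  have hcancel : ∀ (B : Matrix.SpecialLinearGroup (Fin 2) ℂ) (D : Matrix (Fin 2) (Fin 2) ℂ),
      ((B⁻¹ : Matrix.SpecialLinearGroup (Fin 2) ℂ) : Matrix (Fin 2) (Fin 2) ℂ) *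
        ((B : Matrix (Fin 2) (Fin 2) ℂ) * D * (B : Matrix (Fin 2) (Fin 2) ℂ)ᵀ) *
        ((B⁻¹ : Matrix.SpecialLinearGroup (Fin 2) ℂ) : Matrix (Fin 2) (Fin 2) ℂ)ᵀ = D := by
    intro B D
    have h2 := congrArg Matrix.transpose (hinv B)
    rw [Matrix.transpose_mul, Matrix.transpose_one] at h2
    rw [← Matrix.mul_assoc, ← Matrix.mul_assoc, hinv, Matrix.one_mul, Matrix.mul_assoc, h2,
      Matrix.mul_one]
  have hS : ∀ i, symplecticReduction (sloccAct A⁻¹ Φ) i = z i • 1 := by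
    intro i
    rw [symplecticReduction_sloccAct, hA i, Pi.inv_apply, Matrix.mul_smul, Matrix.smul_mul]
    congr 1
    simpa using hcancel (A i) 1
  have hT : ∀ i, (orthogonalReduction (sloccAct A⁻¹ Φ) i).trace ^ 2 -
      4 * (orthogonalReduction (sloccAct A⁻¹ Φ) i).det ≠ 0 := by
    intro i
    have := hdisc i
    rw [← modeDisc_sloccAct A⁻¹, modeDisc_of_symplecticReduction_eq_smul_one hS] at this
    exact right_ne_zero_of_mul this
  choose O l₁ l₂ hl hO hOT using fun i =>
    exists_rotation_diagonal (orthogonalReduction_transpose (sloccAct A⁻¹ Φ) i) (hT i)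
  have hO' : ∀ i, ((O i)⁻¹ : Matrix.SpecialLinearGroup (Fin 2) ℂ) = (O i).transpose := by
    intro i
    rw [inv_eq_iff_mul_eq_one]
    exact Subtype.ext (hO i)
  refine ⟨sloccAct O⁻¹ (sloccAct A⁻¹ Φ), ⟨A * O, ?_⟩, fun i => ⟨z i, hz i, ?_⟩,
    fun i => ⟨l₁ i, l₂ i, hl i, ?_⟩⟩
  · rw [← sloccAct_mul, ← sloccAct_mul, mul_inv_cancel_right, mul_inv_cancel,
      sloccAct_one]
  · rw [symplecticReduction_sloccAct, hS, Pi.inv_apply, Matrix.mul_smul, Matrix.smul_mul]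
    congr 1
    simpa [hO] using hcancel (O i) 1
  · rw [orthogonalReduction_sloccAct, hOT, Pi.inv_apply, hcancel]
    intro j
    rw [Pi.inv_apply, hO']
    simpa using hO j

theorem IsCoreTensor.neg [NeZero n] {Φ Ω : QubitSpace n} (h : IsCoreTensor Φ Ω) :
    IsCoreTensor Φ (-Ω) := by
  have hflat : ∀ i, flattening (-Ω) i = -flattening Ω i := by
    intro i
    ext a w
    simp [flattening]
  refine ⟨?_, fun i => ?_, fun i => ?_⟩
  · obtain ⟨A, rfl⟩ := h.sameOrbit
    -- `-1` lies in `SL₂`; using it in a single mode negates the tensor.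
    have hE := sloccAct_of_forall_eq_smul
      (fun i : Fin n => if i = 0 then (-1 : Matrix.SpecialLinearGroup (Fin 2) ℂ) else 1)
      (fun i => if i = 0 then -1 else 1)
      (fun i => by by_cases hi : i = 0 <;> simp [hi]) (-Ω)
    refine ⟨A * fun i => if i = 0 then -1 else 1, ?_⟩
    rw [sloccAct_mul, hE]
    simp
  · simpa [symplecticReduction, hflat] using h.symplectic i
  · simpa [orthogonalReduction, hflat] using h.orthogonal i

theorem IsCoreTensor.eq_or_eq_neg {Φ Ω Ω' : QubitSpace n} (h : IsCoreTensor Φ Ω)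
    (h' : IsCoreTensor Φ Ω') : Ω' = Ω ∨ Ω' = -Ω := by
  obtain ⟨A, hA⟩ := h.sameOrbit
  obtain ⟨A', hA'⟩ := h'.sameOrbit
  obtain ⟨B, rfl⟩ : ∃ B, Ω' = sloccAct B Ω := by
    refine ⟨A'⁻¹ * A, ?_⟩
    rw [sloccAct_mul, ← hA, hA', ← sloccAct_mul, inv_mul_cancel, sloccAct_one]
  have hB : ∀ i, (B i : Matrix (Fin 2) (Fin 2) ℂ) * (B i : Matrix (Fin 2) (Fin 2) ℂ)ᵀ = 1 := by
    intro i
    obtain ⟨z, hz, hS⟩ := h.symplectic i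
    obtain ⟨z', hz', hS'⟩ := h'.symplectic i
    rw [symplecticReduction_sloccAct, hS] at hS'
    -- Determinants give `z² = z'²`, and the order condition selects the same root.
    obtain rfl : z = z' := by
      refine eq_of_sq_eq_sq_of_lexLT hz hz' ?_
      have := congrArg Matrix.det hS'
      simpa using this
    rw [Matrix.mul_smul, Matrix.smul_mul, Matrix.mul_one] at hS'
    exact smul_right_injective _ (ne_zero_of_lexLT_neg hz) hS'
  have hc : ∀ i, ∃ c : ℂ, (c = 1 ∨ c = -1) ∧ (B i : Matrix (Fin 2) (Fin 2) ℂ) = c • 1 := by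
    intro i
    obtain ⟨l₁, l₂, hl, hT⟩ := h.orthogonal i
    obtain ⟨m₁, m₂, hm, hT'⟩ := h'.orthogonal i
    rw [orthogonalReduction_sloccAct _ fun j => mul_eq_one_comm.1 (hB j), hT] at hT'
    exact eq_sign_of_conj_diagonal hl hm (hB i) hT'
  choose c hc1 hc using hc
  rw [sloccAct_of_forall_eq_smul B c hc]
  have : ∏ i, c i = 1 ∨ ∏ i, c i = -1 := by
    refine sq_eq_sq_iff_eq_or_eq_neg.1 ?_
    rw [← Finset.prod_pow, one_pow]
    exact Finset.prod_eq_one fun i _ => by rcases hc1 i with h | h <;> simp [h]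
  rcases this with h | h
  · exact .inl (by rw [h, one_smul])
  · exact .inr ((coords n).injective (by simp [h]))

/-! ### Holomorphy of the genericity conditions. -/

theorem differentiable_pencilDisc {E : Type*} [NormedAddCommGroup E] [NormedSpace ℂ E]
    {N S : E → Matrix (Fin 2) (Fin 2) ℂ} (hN : ∀ a b, Differentiable ℂ fun x => N x a b)
    (hS : ∀ a b, Differentiable ℂ fun x => S x a b) :
    Differentiable ℂ fun x => pencilDisc (N x) (S x) := by
  simp only [pencilDisc, Matrix.trace_fin_two, Matrix.det_fin_two, Matrix.mul_apply,
    Fin.sum_univ_two, Matrix.adjugate_fin_two, Matrix.of_apply, Matrix.cons_val]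
  fun_prop

theorem differentiable_reduction {B : ((Fin n → Fin 2) → ℂ) → Fin n → Matrix (Fin 2) (Fin 2) ℂ}
    (hB : ∀ j a b, Differentiable ℂ fun x => B x j a b) (i : Fin n) (a b : Fin 2) :
    Differentiable ℂ fun x => reduction ((coords n).symm x) i (B x) a b := by
  simp only [reduction, Matrix.mul_apply, Matrix.transpose_apply, flattening, Matrix.of_apply,
    LinearEquiv.apply_symm_apply, kron_apply]
  fun_prop

theorem differentiable_symplecticReduction (i : Fin n) (a b : Fin 2) :
    Differentiable ℂ fun x => symplecticReduction ((coords n).symm x) i a b := by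
  simp only [symplecticReduction_eq]
  exact differentiable_reduction (B := fun _ _ => J) (fun _ _ _ => differentiable_const _) i a b

theorem differentiable_modeDisc (i : Fin n) :
    Differentiable ℂ fun x => modeDisc ((coords n).symm x) i := by
  refine differentiable_pencilDisc (fun a b => differentiable_reduction (fun j a b => ?_) i a b)
    fun a b => differentiable_symplecticReduction i a b
  have hS := differentiable_symplecticReduction (n := n) j
  fin_cases a <;> fin_cases b <;> simp [Matrix.adjugate_fin_two] <;> fun_prop

/-! ### A tensor at which the conditions hold. -/

section witness

theorem sum_prod_kron_prod {κ : Type*} [Fintype κ] [DecidableEq κ]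
    (B : κ → Matrix (Fin 2) (Fin 2) ℂ) (x y : Fin 2 → ℂ) :
    ∑ w : κ → Fin 2, (∑ v : κ → Fin 2, (∏ j, x (v j)) * kron B v w) * ∏ j, y (w j) =
      ∏ j, x ⬝ᵥ B j *ᵥ y := by
  have h1 : ∀ w : κ → Fin 2, ∑ v : κ → Fin 2, (∏ j, x (v j)) * kron B v w =
      ∏ j, ∑ a, x a * B j a (w j) := by
    intro w
    rw [Finset.prod_univ_sum]
    simp [kron_apply, Finset.prod_mul_distrib]
  have h2 : ∀ j, x ⬝ᵥ B j *ᵥ y = ∑ b, (∑ a, x a * B j a b) * y b := by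
    intro j
    rw [Matrix.dotProduct_mulVec]
    simp [dotProduct, Matrix.vecMul]
  simp only [h1, h2]
  rw [Finset.prod_univ_sum]
  simp [Finset.prod_mul_distrib]

theorem reduction_sum_smul_tprod {ι : Type*} [Fintype ι] (c : ι → ℂ) (x : ι → Fin 2 → ℂ)
    (i : Fin n) (B : Fin n → Matrix (Fin 2) (Fin 2) ℂ) (a b : Fin 2) :
    reduction (∑ r, c r • PiTensorProduct.tprod ℂ fun _ : Fin n => x r) i B a b =
      ∑ r, ∑ s, c r * c s * x r a * x s b *
        ∏ j : {j : Fin n // j ≠ i}, x r ⬝ᵥ B j *ᵥ x s := by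
  have hf : ∀ (a : Fin 2) (w : {j : Fin n // j ≠ i} → Fin 2),
      flattening (∑ r, c r • PiTensorProduct.tprod ℂ fun _ : Fin n => x r) i a w =
        ∑ r, c r * x r a * ∏ j, x r (w j) := by
    intro a w
    simp only [flattening, Matrix.of_apply, map_sum, map_smul, Finset.sum_apply, Pi.smul_apply,
      coords_tprod, smul_eq_mul]
    refine Finset.sum_congr rfl fun r _ => ?_
    rw [Fintype.prod_eq_mul_prod_subtype_ne _ i, mul_assoc]
    congr 2
    · simp [insertAt]
    · exact Finset.prod_congr rfl fun j _ => by simp [insertAt, j.2]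
  have hK : ∀ w, ∑ v, (∑ r, c r * x r a * ∏ j, x r (v j)) *
      kron (fun j : {j : Fin n // j ≠ i} => B j) v w =
      ∑ r, c r * x r a * ∑ v, (∏ j, x r (v j)) *
        kron (fun j : {j : Fin n // j ≠ i} => B j) v w := by
    intro w
    simp only [Finset.sum_mul, Finset.mul_sum, mul_assoc]
    exact Finset.sum_comm
  simp only [reduction, Matrix.mul_apply, Matrix.transpose_apply, hf, ← sum_prod_kron_prod, hK,
    Finset.sum_mul_sum]
  rw [Finset.sum_comm]
  refine Finset.sum_congr rfl fun r _ => ?_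
  rw [Finset.sum_comm]
  refine Finset.sum_congr rfl fun s _ => ?_
  rw [Finset.mul_sum]
  refine Finset.sum_congr rfl fun w _ => ?_
  ring

/-- `|0…0⟩ + |1…1⟩ - ½ (|0⟩ + |1⟩)^{⊗n}`. -/
noncomputable def ghzWitness (n : ℕ) : QubitSpace n :=
  ∑ r : Fin 3, (![1, 1, -1 / 2] : Fin 3 → ℂ) r •
    PiTensorProduct.tprod ℂ fun _ : Fin n => (![![1, 0], ![0, 1], ![1, 1]] : Fin 3 → Fin 2 → ℂ) r

/-- Distinct vectors of the witness pair to `±1` under `J`, whose even power is `1`, and equal ones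
to `0`. The coefficient `-½` makes the off-diagonal entry `1 - ½ - ½` vanish. -/
theorem symplecticReduction_ghzWitness (k : ℕ) (hk : k ≠ 0) (i : Fin (2 * k + 1)) :
    symplecticReduction (ghzWitness (2 * k + 1)) i = -1 := by
  ext a b
  rw [symplecticReduction_eq, ghzWitness, reduction_sum_smul_tprod]
  fin_cases a <;> fin_cases b <;> simp [Fin.sum_univ_three, J, hk] <;> norm_num

theorem modeDisc_ghzWitness (k : ℕ) (hk : 2 ≤ k) (i : Fin (2 * k + 1)) :
    modeDisc (ghzWitness (2 * k + 1)) i ≠ 0 := by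
  have hk0 : k ≠ 0 := by omega
  have hz : ∀ j, symplecticReduction (ghzWitness (2 * k + 1)) j =
      (-1 : ℂ) • (1 : Matrix (Fin 2) (Fin 2) ℂ) := by
    intro j
    simp [symplecticReduction_ghzWitness k hk0]
  rw [modeDisc_of_symplecticReduction_eq_smul_one hz i]
  have hT : orthogonalReduction (ghzWitness (2 * k + 1)) i =
      !![(2 : ℂ) ^ (2 * k) / 4, (2 : ℂ) ^ (2 * k) / 4 - 1;
        (2 : ℂ) ^ (2 * k) / 4 - 1, (2 : ℂ) ^ (2 * k) / 4] := by
    ext a b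
    rw [orthogonalReduction_eq, ghzWitness, reduction_sum_smul_tprod]
    fin_cases a <;> fin_cases b <;> simp [Fin.sum_univ_three, hk0] <;> norm_num <;> ring
  rw [hT]
  -- The discriminant is four times the square of this off-diagonal entry, which vanishes for `k =
  -- 1`; hence `n ≥ 5`.
  have h4 : (2 : ℂ) ^ (2 * k) / 4 - 1 ≠ 0 := by
    obtain ⟨m, rfl⟩ := Nat.exists_eq_add_of_le hk
    intro h
    have : (2 : ℂ) ^ (2 * (2 + m)) = 4 := by linear_combination 4 * h
    have h' : 2 ^ (2 * (2 + m)) = 4 := by exact_mod_cast this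
    have : 2 ^ 3 ≤ 2 ^ (2 * (2 + m)) := Nat.pow_le_pow_right two_pos (by omega)
    omega
  simp [Matrix.det_fin_two, Matrix.trace_fin_two]
  intro h
  exact h4 (pow_eq_zero_iff two_ne_zero |>.1 (by linear_combination h / 4))

end witness

end OddQubits

theorem mainTheorem3 (n : ℕ) (hn : 5 ≤ n) (hodd : Odd n) :
    OddQubits.HoldsGenerically fun Φ : OddQubits.QubitSpace n =>
      ∃ Ω : OddQubits.QubitSpace n, OddQubits.IsCoreTensor Φ Ω ∧
        ∀ Ω' : OddQubits.QubitSpace n,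
          OddQubits.IsCoreTensor Φ Ω' ↔ (Ω' = Ω ∨ Ω' = -Ω) := by
  open OddQubits in
  have : NeZero n := ⟨by omega⟩
  have hS := differentiable_symplecticReduction (n := n)
  have hD := differentiable_modeDisc (n := n)
  refine holdsGenerically_of_differentiable
    (f := fun x => ∏ i, symplecticReduction ((coords n).symm x) i 0 0 *
      (symplecticReduction ((coords n).symm x) i).det * modeDisc ((coords n).symm x) i)
    (w := coords n (ghzWitness n)) ?_ ?_ fun Φ hΦ => ?_
  · simp only [Matrix.det_fin_two]
    fun_prop
  · obtain ⟨k, rfl⟩ := hodd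
    simp only [LinearEquiv.symm_apply_apply]
    refine Finset.prod_ne_zero_iff.2 fun i _ =>
      mul_ne_zero ?_ (modeDisc_ghzWitness k (by omega) i)
    simp [symplecticReduction_ghzWitness k (by omega) i, Matrix.det_fin_two]
  · simp only [LinearEquiv.symm_apply_apply, Finset.prod_ne_zero_iff, Finset.mem_univ,
      true_imp_iff, mul_ne_zero_iff] at hΦ
    obtain ⟨Ω, hΩ⟩ := exists_isCoreTensor hodd (fun i => (hΦ i).1.1) (fun i => (hΦ i).1.2)
      fun i => (hΦ i).2
    refine ⟨Ω, hΩ, fun Ω' => ⟨hΩ.eq_or_eq_neg, ?_⟩⟩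
    rintro (rfl | rfl)
    exacts [hΩ, hΩ.neg]
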